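/- Let $G$ be a group, let $K$ be a field of characteristic $0$, and let $n\ge 1$ be an integer. Let $\Delta=\Delta(K,G)$ be the difference (augmentation) ideal of the group ring $KG$, consisting of all $\sum_{x\in G}\lambda_x x$ with $\sum_{x\in G}\lambda_x=0$, and let $\delta_n(G)=G\cap(1+\Delta^n)$ be the $n$-th dimension subgroup of $G$ with respect to $K$. Let $\gamma_1(G)=G$ and $\gamma_{i+1}(G)=[\gamma_i(G),G]$ be the lower central series of $G$. Then the following hold. 1. (Jennings) An element $x\in G$ belongs to $\delta_n(G)$ if and only if $x^m\in\gamma_n(G)$ for some integer $m>0$. 2. Consequently $\delta_n(G)$ is the isolator of $\gamma_n(G)$ in $G$, that is, the intersection of all subgroups $J$ of $G$ that contain $\gamma_n(G)$ and are isolated in $G$ (meaning that $x\in G$ and $x^m\in J$ for some integer $m>0$ imply $x\in J$). 3. Consequently $\delta_n(G)$ does not depend on $K$: if $L$ is any other field of characteristic $0$, then $G\cap(1+\Delta(L,G)^n)=G\cap(1+\Delta(K,G)^n)$. -/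

import Mathlib

namespace Jennings

variable {G : Type*} [Group G]

/-- The lower central series `γ_n(G)`, numbered from `γ₁(G) = G`, with `γ_{n+1}(G) = [γ_n(G), G]`.
Mathlib numbers the terms from `0`, hence the shift; only `n ≥ 1` is meaningful. -/
def lowerCentralTerm (G : Type*) [Group G] (n : ℕ) : Subgroup G :=
  (⊤ : Subgroup G).lowerCentralSeries (n - 1)

theorem lowerCentralTerm_one : lowerCentralTerm G 1 = ⊤ := rfl

theorem lowerCentralTerm_succ (n : ℕ) (hn : 1 ≤ n) :
    lowerCentralTerm G (n + 1) = ⁅lowerCentralTerm G n, (⊤ : Subgroup G)⁆ := by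
  obtain ⟨k, rfl⟩ := Nat.exists_eq_add_of_le' hn
  rfl

/-- A subgroup `H` of `G` is isolated in `G` if it contains every element of `G` some positive
power of which lies in `H`. -/
def IsIsolated (H : Subgroup G) : Prop :=
  ∀ (x : G) (m : ℕ), 0 < m → x ^ m ∈ H → x ∈ H

/-- The isolator of `H` in `G`: the intersection of all isolated subgroups of `G` that
contain `H`. -/
def isolator (H : Subgroup G) : Subgroup G :=
  sInf {J : Subgroup G | H ≤ J ∧ IsIsolated J}

/-- The augmentation `K G → K`, the `K`-algebra homomorphism sending each group element to `1`. -/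
noncomputable def augmentation (K G : Type*) [Field K] [Group G] : MonoidAlgebra K G →ₐ[K] K :=
  MonoidAlgebra.lift K K G (1 : G →* K)

/-- The difference ideal (augmentation ideal) `Δ` of the group ring `K G`: all elements whose
coefficients sum to zero, see `mem_differenceIdeal`. -/
noncomputable def differenceIdeal (K G : Type*) [Field K] [Group G] :
    Ideal (MonoidAlgebra K G) :=
  RingHom.ker (augmentation K G)

theorem mem_differenceIdeal (K : Type*) [Field K] (u : MonoidAlgebra K G) :
    u ∈ differenceIdeal K G ↔ (u.coeff.sum fun _ a => a) = 0 := by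
  rw [differenceIdeal, RingHom.mem_ker, augmentation, MonoidAlgebra.lift_apply]
  simp

instance differenceIdeal_isTwoSided (K G : Type*) [Field K] [Group G] :
    (differenceIdeal K G).IsTwoSided :=
  inferInstanceAs (RingHom.ker (augmentation K G)).IsTwoSided

/-- The `n`-th dimension subgroup `G ∩ (1 + Δ ^ n)` of `G` with respect to `K`. -/
noncomputable def dimensionSubgroup (K G : Type*) [Field K] [Group G] (n : ℕ) : Subgroup G where
  carrier := {x | MonoidAlgebra.of K G x - 1 ∈ differenceIdeal K G ^ n}
  one_mem' := by
    change MonoidAlgebra.of K G 1 - 1 ∈ differenceIdeal K G ^ n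
    rw [map_one, sub_self]
    exact zero_mem _
  mul_mem' {x y} hx hy := by
    have h : MonoidAlgebra.of K G (x * y) - 1 =
        MonoidAlgebra.of K G x * (MonoidAlgebra.of K G y - 1) + (MonoidAlgebra.of K G x - 1) := by
      rw [map_mul]; noncomm_ring
    change MonoidAlgebra.of K G (x * y) - 1 ∈ differenceIdeal K G ^ n
    rw [h]
    exact add_mem (Ideal.mul_mem_left _ _ hy) hx
  inv_mem' {x} hx := by
    have h : MonoidAlgebra.of K G x⁻¹ - 1 =
        -(MonoidAlgebra.of K G x⁻¹ * (MonoidAlgebra.of K G x - 1)) := by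
      rw [mul_sub, ← map_mul, inv_mul_cancel, map_one, mul_one, neg_sub]
    change MonoidAlgebra.of K G x⁻¹ - 1 ∈ differenceIdeal K G ^ n
    rw [h]
    exact neg_mem (Ideal.mul_mem_left _ _ hx)

theorem mem_dimensionSubgroup (K : Type*) [Field K] (n : ℕ) (x : G) :
    x ∈ dimensionSubgroup K G n ↔ MonoidAlgebra.of K G x - 1 ∈ differenceIdeal K G ^ n :=
  Iff.rfl

end Jennings

namespace Jennings

open scoped commutatorElement
open MonoidAlgebra (of mapDomainAlgHom)

/-! Let `F n` be the set of roots of elements of `γ_n`; everything follows from `δ_n = F n`. Torsion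
elements of a nilpotent group form a subgroup, and commuting powers in a torsion-free nilpotent
group have commuting bases, so `F` is a series of isolated subgroups with `[F i, F j] ≤ F (i + j)`.

One inclusion is direct: `γ_n ≤ δ_n`, and `δ_n` is isolated because positive integers are invertible
in `K`. For the other, `Δ ^ n` lies in `weightFiltration K F n`, so it suffices that `z - 1` in this
span forces `z ∈ F n` (`IsIsolatedNSeries.mem_of_of_sub_one_mem`). Suppose `F w = G` with `w < n`.
After reduction to finitely generated `G`, the quotient `F w / F (w + 1)` is free abelian of finite
rank. A nontrivial coordinate `k : G → ℤ` kills `z`, and the hypothesis descends to `ker k`.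
Removing all coordinates gives `F (w + 1) = G`; once `w ≥ n` the claim is trivial. -/

/-! ### Commutators and torsion in nilpotent groups. -/

theorem commutator_commutator_le_of_rotate {G : Type*} [Group G] {A B C N : Subgroup G} [N.Normal]
    (h₁ : ⁅⁅B, C⁆, A⁆ ≤ N) (h₂ : ⁅⁅C, A⁆, B⁆ ≤ N) : ⁅⁅A, B⁆, C⁆ ≤ N := by
  have key : ∀ H : Subgroup G, H ≤ N ↔ H.map (QuotientGroup.mk' N) = ⊥ := fun H => by
    rw [Subgroup.map_eq_bot_iff, QuotientGroup.ker_mk']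
  rw [key] at *
  simp only [Subgroup.map_commutator] at *
  exact Subgroup.commutator_commutator_eq_bot_of_rotate h₁ h₂

theorem commutator_lowerCentralSeries_le {G : Type*} [Group G] (i j : ℕ) :
    ⁅(⊤ : Subgroup G).lowerCentralSeries i, (⊤ : Subgroup G).lowerCentralSeries j⁆ ≤
      (⊤ : Subgroup G).lowerCentralSeries (i + j + 1) := by
  induction j generalizing i with
  | zero => exact le_of_eq rfl
  | succ j ih =>
    rw [Subgroup.commutator_comm, Subgroup.lowerCentralSeries_succ]
    apply commutator_commutator_le_of_rotate
    · rw [Subgroup.commutator_comm ⊤, ← Subgroup.lowerCentralSeries_succ]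
      refine (ih (i + 1)).trans (le_of_eq ?_)
      congr 1; omega
    · exact Subgroup.commutator_mono (ih i) le_rfl

theorem commutatorElement_pow_left {G : Type*} [Group G] {x y : G} (h : Commute x ⁅x, y⁆) (m : ℕ) :
    ⁅x ^ m, y⁆ = ⁅x, y⁆ ^ m := by
  induction m with
  | zero => simp
  | succ m ih =>
    have h' : x ^ m * ⁅x, y⁆ = ⁅x, y⁆ * x ^ m := (h.pow_left m).eq
    rw [pow_succ, commutatorElement_mul_left_eq_conj_mul, ih, h', pow_succ']
    group

/-- If all elements of `X` have a power in `N`, and commute modulo `N`, then so do all elements of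
the subgroup generated by `X`. -/
theorem exists_pow_mem_of_mem_closure {G : Type*} [Group G] {N : Subgroup G} [N.Normal] {X : Set G}
    (hX : ∀ x ∈ X, ∃ m : ℕ, 0 < m ∧ x ^ m ∈ N)
    (hc : ⁅Subgroup.closure X, Subgroup.closure X⁆ ≤ N) {x : G} (hx : x ∈ Subgroup.closure X) :
    ∃ m : ℕ, 0 < m ∧ x ^ m ∈ N := by
  induction hx using Subgroup.closure_induction with
  | mem x hx => exact hX x hx
  | one => exact ⟨1, one_pos, by simp⟩
  | inv x _ ih =>
    obtain ⟨m, hm, h⟩ := ih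
    exact ⟨m, hm, by rw [inv_pow]; exact inv_mem h⟩
  | mul x y hx hy ihx ihy =>
    obtain ⟨a, ha, hxa⟩ := ihx
    obtain ⟨b, hb, hyb⟩ := ihy
    refine ⟨a * b, Nat.mul_pos ha hb, ?_⟩
    rw [← QuotientGroup.eq_one_iff] at hxa hyb ⊢
    have hcomm : Commute (x : G ⧸ N) (y : G ⧸ N) := by
      rw [← commutatorElement_eq_one_iff_commute]
      exact (QuotientGroup.eq_one_iff _).2 (hc (Subgroup.commutator_mem_commutator hx hy))
    rw [QuotientGroup.mk_pow] at hxa hyb ⊢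
    rw [QuotientGroup.mk_mul]
    rw [hcomm.mul_pow, pow_mul, hxa, mul_comm a b, pow_mul, hyb, one_pow, one_pow, one_mul]

/-- Modulo the next term, `⁅x, y⁆` is central, so `⁅x, y⁆ ^ m = ⁅x ^ m, y⁆`: torsion of one factor
of the series passes to the generators of the next. -/
theorem exists_pow_mem_lowerCentralSeries_succ {G : Type*} [Group G]
    (h : ∀ x : G, ∃ m : ℕ, 0 < m ∧ x ^ m ∈ (⊤ : Subgroup G).lowerCentralSeries 1) (i : ℕ) :
    ∀ x ∈ (⊤ : Subgroup G).lowerCentralSeries i,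
      ∃ m : ℕ, 0 < m ∧ x ^ m ∈ (⊤ : Subgroup G).lowerCentralSeries (i + 1) := by
  induction i with
  | zero => exact fun x _ => h x
  | succ i ih =>
    intro z hz
    refine exists_pow_mem_of_mem_closure
      (X := {g | ∃ x ∈ (⊤ : Subgroup G).lowerCentralSeries i, ∃ y ∈ (⊤ : Subgroup G), ⁅x, y⁆ = g})
      ?_ ?_ hz
    · rintro _ ⟨x, hx, y, -, rfl⟩
      obtain ⟨m, hm, hxm⟩ := ih x hx
      refine ⟨m, hm, ?_⟩
      set N := (⊤ : Subgroup G).lowerCentralSeries (i + 1 + 1)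
      have hxy : ⁅x, y⁆ ∈ (⊤ : Subgroup G).lowerCentralSeries (i + 1) :=
        Subgroup.commutator_mem_commutator hx (Subgroup.mem_top y)
      have h1 : ⁅⁅x, y⁆, x⁆ ∈ N := Subgroup.commutator_mem_commutator hxy (Subgroup.mem_top x)
      have h2 : ⁅x ^ m, y⁆ ∈ N := Subgroup.commutator_mem_commutator hxm (Subgroup.mem_top y)
      rw [← QuotientGroup.eq_one_iff] at h1 h2 ⊢
      have hc : Commute (x : G ⧸ N) ⁅(x : G ⧸ N), (y : G ⧸ N)⁆ :=
        (commutatorElement_eq_one_iff_commute.1 h1).symm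
      have h3 := commutatorElement_pow_left hc m
      change ⁅(x : G ⧸ N), (y : G ⧸ N)⁆ ^ m = 1
      rw [← h3]
      exact h2
    · exact (Subgroup.commutator_mono le_rfl le_top)

theorem exists_pow_eq_one_of_closure_eq_top {G : Type*} [Group G] [Group.IsNilpotent G] {X : Set G}
    (hX : Subgroup.closure X = ⊤) (h : ∀ x ∈ X, ∃ m : ℕ, 0 < m ∧ x ^ m = 1) (x : G) :
    ∃ m : ℕ, 0 < m ∧ x ^ m = 1 := by
  have h1 : ∀ x : G, ∃ m : ℕ, 0 < m ∧ x ^ m ∈ (⊤ : Subgroup G).lowerCentralSeries 1 := fun x =>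
    exists_pow_mem_of_mem_closure (X := X)
      (fun x hx => (h x hx).imp fun m hm => ⟨hm.1, by rw [hm.2]; exact one_mem _⟩)
      (by rw [hX]; exact le_of_eq rfl) (by rw [hX]; exact Subgroup.mem_top x)
  have h2 : ∀ i, ∃ m : ℕ, 0 < m ∧ x ^ m ∈ (⊤ : Subgroup G).lowerCentralSeries i := by
    intro i
    induction i with
    | zero => exact ⟨1, one_pos, Subgroup.mem_top _⟩
    | succ i ih =>
      obtain ⟨a, ha, hxa⟩ := ih
      obtain ⟨b, hb, hxb⟩ := exists_pow_mem_lowerCentralSeries_succ h1 i _ hxa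
      exact ⟨a * b, Nat.mul_pos ha hb, by rwa [pow_mul]⟩
  obtain ⟨n, hn⟩ := Subgroup.nilpotent_iff_lowerCentralSeries.1 ‹Group.IsNilpotent G›
  obtain ⟨m, hm, hxm⟩ := h2 n
  exact ⟨m, hm, by rwa [hn, Subgroup.mem_bot] at hxm⟩

theorem exists_mul_pow_eq_one {G : Type*} [Group G] [Group.IsNilpotent G] {x y : G}
    (hx : ∃ m : ℕ, 0 < m ∧ x ^ m = 1) (hy : ∃ m : ℕ, 0 < m ∧ y ^ m = 1) :
    ∃ m : ℕ, 0 < m ∧ (x * y) ^ m = 1 := by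
  let H := Subgroup.closure {x, y}
  have hxH : x ∈ H := Subgroup.subset_closure (by simp)
  have hyH : y ∈ H := Subgroup.subset_closure (by simp)
  obtain ⟨m, hm, h⟩ := exists_pow_eq_one_of_closure_eq_top (G := H)
    (X := (Subtype.val : H → G) ⁻¹' {x, y}) (Subgroup.closure_closure_coe_preimage)
    (by
      rintro ⟨z, hz⟩ (h | h) <;> change z = _ at h <;> subst h
      · exact hx.imp fun m hm => ⟨hm.1, Subtype.ext hm.2⟩
      · exact hy.imp fun m hm => ⟨hm.1, Subtype.ext hm.2⟩) (⟨x, hxH⟩ * ⟨y, hyH⟩)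
  exact ⟨m, hm, congrArg Subtype.val h⟩

/-- Induction along the upper central series: `⁅x, y⁆` lies one step lower and commutes with `x ^
m`, hence with `x`. Then `⁅x, y⁆ ^ m = ⁅x ^ m, y⁆ = 1`, and torsion-freeness applies. -/
theorem commute_of_commute_pow {G : Type*} [Group G] [Group.IsNilpotent G]
    (hG : ∀ (g : G) (m : ℕ), 0 < m → g ^ m = 1 → g = 1) {x y : G} {m : ℕ} (hm : 0 < m)
    (h : Commute (x ^ m) y) : Commute x y := by
  have key : ∀ (k : ℕ) (y : G), y ∈ Subgroup.upperCentralSeries G k → Commute (x ^ m) y →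
      Commute x y := by
    intro k
    induction k with
    | zero =>
      intro y hy _
      rw [Subgroup.upperCentralSeries_zero, Subgroup.mem_bot] at hy
      rw [hy]; exact Commute.one_right x
    | succ k ih =>
      intro y hy hxy
      have hc : ⁅x, y⁆ ∈ Subgroup.upperCentralSeries G k := by
        rw [← inv_mem_iff, commutatorElement_inv]
        exact Subgroup.mem_upperCentralSeries_succ_iff.1 hy x
      have hx : Commute (x ^ m) x := (Commute.refl x).pow_left m
      have hcx := ih _ hc (by
        rw [commutatorElement_def]
        exact ((hx.mul_right hxy).mul_right hx.inv_right).mul_right hxy.inv_right)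
      have h1 := commutatorElement_pow_left hcx m
      rw [commutatorElement_eq_one_iff_commute.2 hxy] at h1
      exact commutatorElement_eq_one_iff_commute.1 (hG _ m hm h1.symm)
  obtain ⟨n, hn⟩ := Group.IsNilpotent.nilpotent G
  exact key n y (by rw [hn]; exact Subgroup.mem_top y) h

theorem isNilpotent_quotient_of_lowerCentralSeries_le {G : Type*} [Group G] {N : Subgroup G}
    [N.Normal] {n : ℕ} (h : (⊤ : Subgroup G).lowerCentralSeries n ≤ N) :
    Group.IsNilpotent (G ⧸ N) := by
  rw [Subgroup.nilpotent_iff_lowerCentralSeries]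
  refine ⟨n, ?_⟩
  rw [← Subgroup.map_top_of_surjective _ (QuotientGroup.mk'_surjective N),
    ← Subgroup.map_lowerCentralSeries, Subgroup.map_eq_bot_iff, QuotientGroup.ker_mk']
  exact h

/-! ### Roots of the lower central terms. -/

instance lowerCentralTerm_normal (G : Type*) [Group G] (n : ℕ) : (lowerCentralTerm G n).Normal :=
  inferInstanceAs ((⊤ : Subgroup G).lowerCentralSeries (n - 1)).Normal

/-- The subgroup of all elements having a positive power in `γ_n(G)`. -/
def rootLowerCentralTerm (G : Type*) [Group G] (n : ℕ) : Subgroup G where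
  carrier := {x | ∃ m : ℕ, 0 < m ∧ x ^ m ∈ lowerCentralTerm G n}
  one_mem' := ⟨1, one_pos, by simp⟩
  inv_mem' {x} := fun ⟨m, hm, h⟩ => ⟨m, hm, by rw [inv_pow]; exact inv_mem h⟩
  mul_mem' {x y} hx hy := by
    -- Modulo `γ_n` the claim is that torsion elements of a nilpotent group are closed under
    -- products.
    have : Group.IsNilpotent (G ⧸ lowerCentralTerm G n) :=
      isNilpotent_quotient_of_lowerCentralSeries_le (n := n - 1) le_rfl
    simp only [Set.mem_ofPred_eq, ← QuotientGroup.eq_one_iff, QuotientGroup.mk_pow,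
      QuotientGroup.mk_mul] at hx hy ⊢
    exact exists_mul_pow_eq_one hx hy

theorem mem_rootLowerCentralTerm {G : Type*} [Group G] {n : ℕ} {x : G} :
    x ∈ rootLowerCentralTerm G n ↔ ∃ m : ℕ, 0 < m ∧ x ^ m ∈ lowerCentralTerm G n := Iff.rfl

instance rootLowerCentralTerm_normal (G : Type*) [Group G] (n : ℕ) :
    (rootLowerCentralTerm G n).Normal where
  conj_mem x hx g := by
    obtain ⟨m, hm, h⟩ := hx
    exact ⟨m, hm, by rw [conj_pow]; exact (lowerCentralTerm_normal G n).conj_mem _ h g⟩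

theorem isIsolated_rootLowerCentralTerm (G : Type*) [Group G] (n : ℕ) :
    IsIsolated (rootLowerCentralTerm G n) := by
  rintro x a ha ⟨b, hb, h⟩
  exact ⟨a * b, Nat.mul_pos ha hb, by rwa [pow_mul]⟩

theorem lowerCentralTerm_le_rootLowerCentralTerm (G : Type*) [Group G] (n : ℕ) :
    lowerCentralTerm G n ≤ rootLowerCentralTerm G n :=
  fun x hx => ⟨1, one_pos, by rwa [pow_one]⟩

theorem rootLowerCentralTerm_antitone (G : Type*) [Group G] :
    Antitone (rootLowerCentralTerm G) := by
  rintro i j hij x ⟨m, hm, h⟩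
  exact ⟨m, hm, (⊤ : Subgroup G).lowerCentralSeries_antitone (Nat.sub_le_sub_right hij 1) h⟩

theorem commutator_lowerCentralTerm_le (G : Type*) [Group G] (i j : ℕ) :
    ⁅lowerCentralTerm G i, lowerCentralTerm G j⁆ ≤ lowerCentralTerm G (i + j) :=
  (commutator_lowerCentralSeries_le (i - 1) (j - 1)).trans
    ((⊤ : Subgroup G).lowerCentralSeries_antitone (by omega))

/-- Modulo `F (i + j)` the group is nilpotent and torsion-free, and powers of `x` and `y` commute
there; the exponents can be removed one at a time. -/
theorem commutatorElement_mem_rootLowerCentralTerm {G : Type*} [Group G] {i j : ℕ} {x y : G}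
    (hx : x ∈ rootLowerCentralTerm G i) (hy : y ∈ rootLowerCentralTerm G j) :
    ⁅x, y⁆ ∈ rootLowerCentralTerm G (i + j) := by
  obtain ⟨a, ha, hxa⟩ := hx
  obtain ⟨b, hb, hyb⟩ := hy
  set N := rootLowerCentralTerm G (i + j)
  have : Group.IsNilpotent (G ⧸ N) := isNilpotent_quotient_of_lowerCentralSeries_le
    (lowerCentralTerm_le_rootLowerCentralTerm G (i + j))
  have htf : ∀ (g : G ⧸ N) (m : ℕ), 0 < m → g ^ m = 1 → g = 1 := by
    intro g m hm h
    obtain ⟨g, rfl⟩ := QuotientGroup.mk_surjective g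
    rw [← QuotientGroup.mk_pow, QuotientGroup.eq_one_iff] at h
    exact (QuotientGroup.eq_one_iff _).2 (isIsolated_rootLowerCentralTerm G _ g m hm h)
  have hab : ⁅x ^ a, y ^ b⁆ ∈ N := lowerCentralTerm_le_rootLowerCentralTerm G _
    (commutator_lowerCentralTerm_le G i j (Subgroup.commutator_mem_commutator hxa hyb))
  rw [← QuotientGroup.eq_one_iff] at hab ⊢
  have hc : Commute ((x : G ⧸ N) ^ a) ((y : G ⧸ N) ^ b) :=
    commutatorElement_eq_one_iff_commute.1 hab
  exact commutatorElement_eq_one_iff_commute.2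
    (commute_of_commute_pow htf hb (commute_of_commute_pow htf ha hc).symm).symm

theorem isolator_lowerCentralTerm (G : Type*) [Group G] (n : ℕ) :
    isolator (lowerCentralTerm G n) = rootLowerCentralTerm G n := by
  apply le_antisymm
  · exact sInf_le ⟨lowerCentralTerm_le_rootLowerCentralTerm G n,
      isIsolated_rootLowerCentralTerm G n⟩
  · refine le_sInf ?_
    rintro J ⟨hJ, hJ'⟩ x ⟨m, hm, h⟩
    exact hJ' x m hm (hJ h)

/-! ### Isolated series and the weight filtration of the group ring. -/

/-- A descending series of subgroups `F 0 = G ≥ F 1 ≥ ⋯` with `[F i, F j] ≤ F (i + j)`, all of whose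
terms are isolated. -/
structure IsIsolatedNSeries {G : Type*} [Group G] (F : ℕ → Subgroup G) : Prop where
  zero : F 0 = ⊤
  antitone : Antitone F
  commutator_mem : ∀ {i j : ℕ} {x y : G}, x ∈ F i → y ∈ F j → ⁅x, y⁆ ∈ F (i + j)
  isolated : ∀ i, IsIsolated (F i)

theorem IsIsolatedNSeries.comap {G H : Type*} [Group G] [Group H] {F : ℕ → Subgroup G}
    (hF : IsIsolatedNSeries F) (f : H →* G) : IsIsolatedNSeries fun i => (F i).comap f where
  zero := by simp [hF.zero]
  antitone _ _ h := Subgroup.comap_mono (hF.antitone h)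
  commutator_mem {i j x y} hx hy := by
    rw [Subgroup.mem_comap, map_commutatorElement]
    exact hF.commutator_mem hx hy
  isolated i x m hm h := hF.isolated i (f x) m hm (by rw [← map_pow]; exact h)

theorem IsIsolatedNSeries.normal {G : Type*} [Group G] {F : ℕ → Subgroup G}
    (hF : IsIsolatedNSeries F) (i : ℕ) : (F i).Normal where
  conj_mem x hx g := by
    have h := hF.commutator_mem (i := 0) (x := g) (by rw [hF.zero]; exact Subgroup.mem_top g) hx
    rw [zero_add] at h
    simpa [commutatorElement_def] using mul_mem h hx

/-- The span of all products `(g₁ - 1) ⋯ (g_k - 1)` of total weight at least `n`, where `g - 1` has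
weight `i` if `g ∈ F i`. -/
noncomputable def weightFiltration (K : Type*) [Field K] {G : Type*} [Group G] (F : ℕ → Subgroup G) (n : ℕ) :
    Submodule K (MonoidAlgebra K G) :=
  Submodule.span K {a | ∃ l : List (G × ℕ), (∀ p ∈ l, p.1 ∈ F p.2) ∧ n ≤ (l.map Prod.snd).sum ∧
    (l.map fun p => of K G p.1 - 1).prod = a}

section weightFiltration

variable {K : Type*} [Field K] {G : Type*} [Group G] {F : ℕ → Subgroup G}

theorem list_prod_mem_weightFiltration {l : List (G × ℕ)} (hl : ∀ p ∈ l, p.1 ∈ F p.2) {n : ℕ}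
    (hn : n ≤ (l.map Prod.snd).sum) :
    (l.map fun p => of K G p.1 - 1).prod ∈ weightFiltration K F n :=
  Submodule.subset_span ⟨l, hl, hn, rfl⟩

/-- To map the filtration into a filtration indexed by the same weights it suffices to treat
products. -/
theorem map_mem_of_forall_list {M : Type*} [AddCommGroup M] [Module K M]
    (f : MonoidAlgebra K G →ₗ[K] M) {n : ℕ} {S : Submodule K M}
    (h : ∀ l : List (G × ℕ), (∀ p ∈ l, p.1 ∈ F p.2) → n ≤ (l.map Prod.snd).sum →
      f (l.map fun p => of K G p.1 - 1).prod ∈ S)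
    {a : MonoidAlgebra K G} (ha : a ∈ weightFiltration K F n) : f a ∈ S := by
  have : weightFiltration K F n ≤ S.comap f := by
    refine Submodule.span_le.2 ?_
    rintro _ ⟨l, hl, hn, rfl⟩
    exact h l hl hn
  exact this ha

theorem weightFiltration_antitone : Antitone (weightFiltration K F) := by
  intro m n hmn
  refine Submodule.span_mono ?_
  rintro _ ⟨l, hl, hn, rfl⟩
  exact ⟨l, hl, hmn.trans hn, rfl⟩

theorem mul_mem_weightFiltration {i j : ℕ} {a b : MonoidAlgebra K G}
    (ha : a ∈ weightFiltration K F i) (hb : b ∈ weightFiltration K F j) :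
    a * b ∈ weightFiltration K F (i + j) := by
  have h := Submodule.mul_mem_mul ha hb
  rw [weightFiltration, weightFiltration, Submodule.span_mul_span] at h
  refine Submodule.span_mono ?_ h
  rintro _ ⟨_, ⟨l, hl, hi, rfl⟩, _, ⟨l', hl', hj, rfl⟩, rfl⟩
  refine ⟨l ++ l', ?_, ?_, ?_⟩
  · intro p hp
    rcases List.mem_append.1 hp with hp | hp
    exacts [hl p hp, hl' p hp]
  · rw [List.map_append, List.sum_append]; omega
  · simp

theorem of_sub_one_mem_weightFiltration {g : G} {i : ℕ} (hg : g ∈ F i) :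
    of K G g - 1 ∈ weightFiltration K F i :=
  Submodule.subset_span ⟨[(g, i)], by simpa using hg, by simp, by simp⟩

theorem of_mem_weightFiltration_zero (h0 : F 0 = ⊤) (g : G) :
    of K G g ∈ weightFiltration K F 0 := by
  have h1 : (1 : MonoidAlgebra K G) ∈ weightFiltration K F 0 :=
    Submodule.subset_span ⟨[], by simp, by simp, by simp⟩
  simpa using add_mem (of_sub_one_mem_weightFiltration (K := K) (g := g) (i := 0)
    (by rw [h0]; exact Subgroup.mem_top g)) h1

theorem mapDomainAlgHom_of {H : Type*} [Group H] (f : G →* H) (g : G) :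
    mapDomainAlgHom K K f (of K G g) = of K H (f g) := by simp

theorem map_mem_weightFiltration {H : Type*} [Group H] {F' : ℕ → Subgroup H} (f : G →* H)
    (hf : ∀ i g, g ∈ F i → f g ∈ F' i) {n : ℕ} {a : MonoidAlgebra K G}
    (ha : a ∈ weightFiltration K F n) : mapDomainAlgHom K K f a ∈ weightFiltration K F' n := by
  refine map_mem_of_forall_list (mapDomainAlgHom K K f).toLinearMap (fun l hl hn => ?_) ha
  refine Submodule.subset_span ⟨l.map fun p => (f p.1, p.2), ?_, ?_, ?_⟩
  · intro p hp
    obtain ⟨q, hq, rfl⟩ := List.mem_map.1 hp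
    exact hf _ _ (hl q hq)
  · simpa [List.map_map, Function.comp_def] using hn
  · rw [AlgHom.toLinearMap_apply, map_list_prod, List.map_map, List.map_map]
    refine congrArg List.prod (List.map_congr_left fun p _ => ?_)
    rw [Function.comp_apply, Function.comp_apply, map_sub, map_one, mapDomainAlgHom_of]

/-- An endomorphism of `G` that moves the terms of the series `w` steps down does the same to the
filtration. -/
theorem map_sub_self_mem_weightFiltration (h0 : F 0 = ⊤) (f : G →* G) {w : ℕ}
    (hf : ∀ i g, g ∈ F i → f g * g⁻¹ ∈ F (i + w)) {n : ℕ} {a : MonoidAlgebra K G}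
    (ha : a ∈ weightFiltration K F n) :
    mapDomainAlgHom K K f a - a ∈ weightFiltration K F (n + w) := by
  refine map_mem_of_forall_list ((mapDomainAlgHom K K f).toLinearMap - LinearMap.id)
    (fun l hl hn => weightFiltration_antitone (Nat.add_le_add_right hn w) ?_) ha
  clear hn
  induction l with
  | nil => simp
  | cons p l ih =>
    rw [List.forall_mem_cons] at hl
    have ih' := ih hl.2
    set P := (l.map fun p => of K G p.1 - 1).prod
    have hPm : P ∈ weightFiltration K F (l.map Prod.snd).sum :=
      list_prod_mem_weightFiltration hl.2 le_rfl
    simp only [LinearMap.sub_apply, AlgHom.toLinearMap_apply, LinearMap.id_apply] at ih' ⊢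
    -- With `g = p.1`, this is `f g - g = (f g * g⁻¹ - 1) * g`.
    have hg : of K G (f p.1) - of K G p.1 ∈ weightFiltration K F (p.2 + w) := by
      have h := mul_mem_weightFiltration
        (of_sub_one_mem_weightFiltration (K := K) (hf p.2 p.1 hl.1))
        (of_mem_weightFiltration_zero (K := K) h0 p.1)
      rwa [sub_mul, ← map_mul, one_mul, inv_mul_cancel_right, add_zero] at h
    have hτP : mapDomainAlgHom K K f P ∈ weightFiltration K F (l.map Prod.snd).sum := by
      simpa using add_mem (weightFiltration_antitone (Nat.le_add_right _ w) ih') hPm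
    have key : mapDomainAlgHom K K f ((of K G p.1 - 1) * P) - (of K G p.1 - 1) * P =
        (of K G (f p.1) - of K G p.1) * mapDomainAlgHom K K f P +
        (of K G p.1 - 1) * (mapDomainAlgHom K K f P - P) := by
      rw [map_mul, map_sub, map_one, mapDomainAlgHom_of]
      noncomm_ring
    simp only [List.map_cons, List.prod_cons, List.sum_cons]
    rw [key]
    refine add_mem ?_ ?_
    · have h := mul_mem_weightFiltration hg hτP
      rwa [add_right_comm] at h
    · have h := mul_mem_weightFiltration (of_sub_one_mem_weightFiltration (K := K) hl.1) ih'
      rwa [← add_assoc] at h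

/-- A homomorphism to `ℤ` that kills `F (w + 1)`, where `F w = G`, kills every `g` with `g - 1` of
weight greater than `w`. -/
theorem eq_one_of_of_sub_one_mem_weightFiltration [CharZero K] {w n : ℕ} (hn : w < n)
    (hanti : Antitone F) (k : G →* Multiplicative ℤ) (hk : F (w + 1) ≤ k.ker) {z : G}
    (hz : of K G z - 1 ∈ weightFiltration K F n) : k z = 1 := by
  -- The map `g ↦ 1 + k(g) ε` is multiplicative since `ε² = 0`. Its linear extension kills products
  -- of two or more factors `g - 1`; a single factor of weight above `w` has `g ∈ ker k`, and the
  -- empty product has weight `0 < n`.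
  let d : G →* DualNumber K :=
    { toFun := fun g => 1 + TrivSqZeroExt.inr ((k g).toAdd : K)
      map_one' := by simp
      map_mul' := fun x y => by
        rw [map_mul, toAdd_mul, Int.cast_add, TrivSqZeroExt.inr_add, mul_add, add_mul, add_mul,
          TrivSqZeroExt.inr_mul_inr]
        simp [add_assoc] }
  let D : MonoidAlgebra K G →ₐ[K] DualNumber K := MonoidAlgebra.lift K (DualNumber K) G d
  have hD : ∀ g, D (of K G g - 1) = TrivSqZeroExt.inr ((k g).toAdd : K) := by
    intro g
    rw [map_sub, map_one, MonoidAlgebra.lift_of]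
    simp [d]
  have h : D (of K G z - 1) ∈ (⊥ : Submodule K (DualNumber K)) := by
    refine map_mem_of_forall_list D.toLinearMap (fun l hl hln => ?_) hz
    rw [Submodule.mem_bot, AlgHom.toLinearMap_apply, map_list_prod, List.map_map]
    match l with
    | [] => simp at hln; omega
    | [p] =>
      have hp : k p.1 = 1 := hk (hanti (by simp at hln; omega) (hl p (by simp)))
      simp only [List.map_cons, List.map_nil, List.prod_singleton, Function.comp_apply, hD, hp]
      simp
    | p :: q :: l =>
      simp only [List.map_cons, List.prod_cons, Function.comp_apply, hD]
      rw [← mul_assoc, TrivSqZeroExt.inr_mul_inr, zero_mul]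
  rw [Submodule.mem_bot, hD, ← TrivSqZeroExt.inr_zero,
    TrivSqZeroExt.inr_injective.eq_iff, Int.cast_eq_zero] at h
  exact toAdd_eq_zero.1 h

end weightFiltration

/-! ### Splitting off one infinite cyclic factor. -/

/-- Passing to the kernel `N` of a homomorphism `k` onto `ℤ`: `K N` is a module over `K G`, where
`g` acts by `v ↦ g v t ^ (-k g)`, and `v ↦ v • 1` is compatible with the filtrations. -/
theorem of_sub_one_mem_weightFiltration_ker {K : Type*} [Field K] {G : Type*} [Group G]
    {F : ℕ → Subgroup G} (hF : IsIsolatedNSeries F) {w n : ℕ} (hw : F w = ⊤)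
    (k : G →* Multiplicative ℤ) (hk : F (w + 1) ≤ k.ker)
    (hsurj : Function.Surjective k) {z : G} (hz : z ∈ k.ker)
    (h : of K G z - 1 ∈ weightFiltration K F n) :
    of K k.ker ⟨z, hz⟩ - 1 ∈ weightFiltration K (fun i => (F i).comap k.ker.subtype) n := by
  obtain ⟨t, ht⟩ := hsurj (Multiplicative.ofAdd 1)
  set F' : ℕ → Subgroup k.ker := fun i => (F i).comap k.ker.subtype
  have hN : IsIsolatedNSeries F' := hF.comap k.ker.subtype
  let s : G →* G := (zpowersHom G t).comp k
  have hs : ∀ g, k (s g) = k g := by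
    intro g
    change k (t ^ (k g).toAdd) = k g
    rw [map_zpow, ht, ← ofAdd_zsmul]
    simp
  have hsF : ∀ i g, g ∈ F i → s g ∈ F i := by
    intro i g hg
    -- Up to `w` the series is all of `G`; beyond it, `k g = 1` and so `s g = 1`.
    by_cases hi : i ≤ w
    · rw [show F i = ⊤ from top_le_iff.1 (hw ▸ hF.antitone hi)]
      exact Subgroup.mem_top _
    · have h1 : k g = 1 := hk (hF.antitone (by omega) hg)
      change t ^ (k g).toAdd ∈ F i
      rw [h1, toAdd_one, zpow_zero]
      exact one_mem _
  let q : G → k.ker := fun g => ⟨g * (s g)⁻¹, by rw [MonoidHom.mem_ker, map_mul, map_inv, hs,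
    mul_inv_cancel]⟩
  let τ : G → (k.ker →* k.ker) := fun g => (MulAut.conjNormal (s g) : MulAut k.ker).toMonoidHom
  have hτ : ∀ g (x : k.ker), ((τ g x : k.ker) : G) = s g * x * (s g)⁻¹ := fun g x =>
    MulAut.conjNormal_apply (s g) x
  let θ : MonoidAlgebra K G →ₗ[K] MonoidAlgebra K k.ker := MonoidAlgebra.mapDomainLinearMap K K q
  have hθ : ∀ g, θ (of K G g) = of K k.ker (q g) := fun g => by
    simp [θ]
  -- This linearizes the cocycle identity `q (g * x) = q g * (s g * q x * (s g)⁻¹)`.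
  have hθmul : ∀ g a, θ (of K G g * a) = of K k.ker (q g) * mapDomainAlgHom K K (τ g) (θ a) := by
    intro g a
    induction a using MonoidAlgebra.induction_on with
    | of x =>
      rw [← map_mul, hθ, hθ, mapDomainAlgHom_of, ← map_mul]
      congr 1
      apply Subtype.ext
      rw [Subgroup.coe_mul, hτ]
      simp only [q, map_mul]
      group
    | add a b ha hb => rw [mul_add, map_add, map_add, map_add, ha, hb, mul_add]
    | smul c a ha => rw [mul_smul_comm, map_smul, map_smul, map_smul, ha, mul_smul_comm]
  have hθE : θ (of K G z - 1) ∈ weightFiltration K F' n := by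
    refine map_mem_of_forall_list θ (fun l hl hn => weightFiltration_antitone hn ?_) h
    clear hn
    induction l with
    | nil =>
      simp only [List.map_nil, List.prod_nil, List.sum_nil]
      rw [← map_one (of K G), hθ]
      exact of_mem_weightFiltration_zero hN.zero _
    | cons p l ih =>
      rw [List.forall_mem_cons] at hl
      specialize ih hl.2
      obtain ⟨g, i⟩ := p
      simp only [List.map_cons, List.prod_cons, List.sum_cons]
      set P := (l.map fun p => of K G p.1 - 1).prod
      have hsg := hsF i g hl.1
      have hq : q g ∈ F' i := by
        change g * (s g)⁻¹ ∈ F i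
        exact mul_mem hl.1 (inv_mem hsg)
      -- Since `τ g x * x⁻¹ = ⁅s g, x⁆` with `s g ∈ F i`, conjugation by `s g` raises weights by
      -- `i`.
      have hτP : mapDomainAlgHom K K (τ g) (θ P) - θ P ∈
          weightFiltration K F' ((l.map Prod.snd).sum + i) := by
        refine map_sub_self_mem_weightFiltration hN.zero (τ g) (fun j x hx => ?_) ih
        change ((τ g x * x⁻¹ : k.ker) : G) ∈ F (j + i)
        rw [Subgroup.coe_mul, hτ, Subgroup.coe_inv, add_comm, ← commutatorElement_def]
        exact hF.commutator_mem hsg hx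
      have hτP' : mapDomainAlgHom K K (τ g) (θ P) ∈
          weightFiltration K F' (l.map Prod.snd).sum := by
        simpa using add_mem (weightFiltration_antitone (Nat.le_add_right _ i) hτP) ih
      have key : θ ((of K G g - 1) * P) =
          (of K k.ker (q g) - 1) * mapDomainAlgHom K K (τ g) (θ P) +
          (mapDomainAlgHom K K (τ g) (θ P) - θ P) := by
        rw [sub_mul, one_mul, map_sub, hθmul]
        noncomm_ring
      rw [key]
      refine add_mem (mul_mem_weightFiltration (of_sub_one_mem_weightFiltration hq) hτP') ?_
      rwa [add_comm]
  have hq1 : q 1 = 1 := Subtype.ext (by simp [q])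
  have hqz : q z = ⟨z, hz⟩ := Subtype.ext (by
    have h1 : s z = 1 := by
      change t ^ (k z).toAdd = 1
      rw [MonoidHom.mem_ker.1 hz, toAdd_one, zpow_zero]
    simp [q, h1])
  rwa [map_sub, ← map_one (of K G), hθ, hθ, hq1, hqz, map_one] at hθE

/-- A homomorphism to `ℤ` is trivial or factors as a surjection to `ℤ` with the same kernel. -/
theorem exists_surjective_ker_eq {G : Type*} [Group G] (f : G →* Multiplicative ℤ) (hf : f ≠ 1) :
    ∃ k : G →* Multiplicative ℤ, Function.Surjective k ∧ k.ker = f.ker := by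
  -- The image of `f` is `dℤ` with `d ≠ 0`; `k` is `f` divided by `d`.
  obtain ⟨d, hd⟩ := Int.subgroup_cyclic (Subgroup.toAddSubgroup' f.range)
  have hmem : ∀ x : Multiplicative ℤ, x ∈ f.range ↔ ∃ c : ℤ, c * d = x.toAdd := by
    intro x
    have : x ∈ f.range ↔ x.toAdd ∈ Subgroup.toAddSubgroup' f.range := Iff.rfl
    rw [this, hd, AddSubgroup.mem_closure_singleton]
    simp
  have hd0 : d ≠ 0 := by
    rintro rfl
    refine hf (MonoidHom.ext fun g => ?_)
    obtain ⟨c, hc⟩ := (hmem (f g)).1 ⟨g, rfl⟩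
    rw [mul_zero] at hc
    exact toAdd_eq_zero.1 hc.symm
  choose c hc using fun g => (hmem (f g)).1 ⟨g, rfl⟩
  refine ⟨MonoidHom.mk' (fun g => Multiplicative.ofAdd (c g)) fun x y => ?_, fun x => ?_, ?_⟩
  · rw [← ofAdd_add]
    refine congrArg _ (mul_right_cancel₀ hd0 ?_)
    rw [hc, map_mul, toAdd_mul, add_mul, hc, hc]
  · obtain ⟨g, hg⟩ := (hmem (Multiplicative.ofAdd (x.toAdd * d))).2 ⟨x.toAdd, rfl⟩
    refine ⟨g, congrArg Multiplicative.ofAdd (mul_right_cancel₀ hd0 (b := d) ?_ : c g = x.toAdd)⟩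
    rw [hc, hg]; rfl
  · ext g
    rw [MonoidHom.mem_ker, MonoidHom.mem_ker, MonoidHom.mk'_apply, ofAdd_eq_one, ← toAdd_eq_zero,
      ← hc, mul_eq_zero, or_iff_left hd0]

/-- Downward induction step, for `F w / F (w + 1)` embedded in a free abelian group of finite
rank. -/
theorem mem_of_quotient_embeds_free.{u} {K : Type*} [Field K] [CharZero K] {w n : ℕ}
    (ih : ∀ (G : Type u) [Group G] (F : ℕ → Subgroup G), IsIsolatedNSeries F → F (w + 1) = ⊤ →
      ∀ z : G, of K G z - 1 ∈ weightFiltration K F n → z ∈ F n) (r : ℕ) :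
    ∀ (G : Type u) [Group G] (F : ℕ → Subgroup G), IsIsolatedNSeries F → F w = ⊤ →
      ∀ φ : G →* (Fin r → Multiplicative ℤ), φ.ker = F (w + 1) →
      ∀ z : G, of K G z - 1 ∈ weightFiltration K F n → z ∈ F n := by
  induction r with
  | zero =>
    intro G _ F hF hw φ hφ
    refine ih G F hF ?_
    rw [← hφ, MonoidHom.ker_eq_top_iff]
    exact MonoidHom.ext fun g => Subsingleton.elim _ _
  | succ r ihr =>
    intro G _ F hF hw φ hφ z hz
    by_cases hn : n ≤ w
    · exact hF.antitone hn (hw ▸ Subgroup.mem_top z)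
    let f : G →* Multiplicative ℤ := (Pi.evalMonoidHom _ 0).comp φ
    let φ' : G →* (Fin r → Multiplicative ℤ) :=
      MonoidHom.pi fun j => (Pi.evalMonoidHom _ j.succ).comp φ
    have hker : ∀ g, φ g = 1 ↔ f g = 1 ∧ φ' g = 1 := by
      intro g
      simp only [funext_iff, Fin.forall_fin_succ]
      rfl
    have hFf : F (w + 1) ≤ f.ker := by
      rw [← hφ]
      exact fun g hg => ((hker g).1 hg).1
    by_cases hf : f = 1
    · refine ihr G F hF hw φ' ?_ z hz
      rw [← hφ]
      ext g
      rw [MonoidHom.mem_ker, MonoidHom.mem_ker, hker, hf]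
      simp
    -- On `ker k = ker f` the first coordinate vanishes, so the other `r` coordinates already have
    -- kernel `F (w + 1)` there.
    · obtain ⟨k, hk, hkf⟩ := exists_surjective_ker_eq f hf
      have hFk : F (w + 1) ≤ k.ker := hkf ▸ hFf
      have hzk : z ∈ k.ker := eq_one_of_of_sub_one_mem_weightFiltration (not_le.1 hn) hF.antitone k
        hFk hz
      refine ihr k.ker _ (hF.comap k.ker.subtype) (by rw [hw, Subgroup.comap_top])
        (φ'.comp k.ker.subtype) ?_ ⟨z, hzk⟩
        (of_sub_one_mem_weightFiltration_ker hF hw k hFk hk hzk hz)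
      ext ⟨g, hg⟩
      rw [hkf] at hg
      rw [MonoidHom.mem_ker, Subgroup.mem_comap, ← hφ, MonoidHom.mem_ker]
      change φ' g = 1 ↔ φ g = 1
      rw [hker]
      exact (and_iff_right hg).symm

/-! ### Finitely generated reduction and the downward induction. -/

/-- The quotient `G / F (w + 1)` is abelian because `2 * w ≥ w + 1`, and torsion-free because `F (w
+ 1)` is isolated; being finitely generated, it is free. -/
theorem IsIsolatedNSeries.exists_ker_eq {G : Type*} [Group G] [Group.FG G] {F : ℕ → Subgroup G}
    (hF : IsIsolatedNSeries F) {w : ℕ} (hw1 : 1 ≤ w) (hw : F w = ⊤) :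
    ∃ (r : ℕ) (φ : G →* (Fin r → Multiplicative ℤ)), φ.ker = F (w + 1) := by
  have := hF.normal (w + 1)
  let _ : CommGroup (G ⧸ F (w + 1)) :=
    { (inferInstance : Group (G ⧸ F (w + 1))) with
      mul_comm := fun a b => by
        obtain ⟨x, rfl⟩ := QuotientGroup.mk_surjective a
        obtain ⟨y, rfl⟩ := QuotientGroup.mk_surjective b
        have h : ⁅x, y⁆ ∈ F (w + 1) := hF.antitone (by omega) (hF.commutator_mem (i := w) (j := w)
          (hw ▸ Subgroup.mem_top x) (hw ▸ Subgroup.mem_top y))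
        exact commutatorElement_eq_one_iff_mul_comm.1 ((QuotientGroup.eq_one_iff _).2 h) }
  let A := Additive (G ⧸ F (w + 1))
  have : Module.Finite ℤ A := by
    rw [Module.Finite.iff_addGroup_fg]
    infer_instance
  have : IsMulTorsionFree (G ⧸ F (w + 1)) := by
    rw [isMulTorsionFree_iff_not_isOfFinOrder]
    intro a ha hfin
    obtain ⟨x, rfl⟩ := QuotientGroup.mk_surjective a
    obtain ⟨m, hm, h⟩ := isOfFinOrder_iff_pow_eq_one.1 hfin
    rw [← QuotientGroup.mk_pow, QuotientGroup.eq_one_iff] at h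
    exact ha ((QuotientGroup.eq_one_iff _).2 (hF.isolated _ x m hm h))
  let b := Module.finBasis ℤ A
  let e : A ≃+ (Fin (Module.finrank ℤ A) → ℤ) := b.equivFun.toAddEquiv
  refine ⟨Module.finrank ℤ A, MonoidHom.mk' (fun g j => Multiplicative.ofAdd
    (e (Additive.ofMul (QuotientGroup.mk g)) j)) fun x y => ?_, ?_⟩
  · funext j
    rw [QuotientGroup.mk_mul, ofMul_mul, map_add]
    rfl
  · ext g
    have h : (QuotientGroup.mk g : G ⧸ F (w + 1)) = 1 ↔
        e (Additive.ofMul (QuotientGroup.mk g)) = 0 := by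
      rw [e.map_eq_zero_iff, ofMul_eq_zero]
    rw [MonoidHom.mem_ker, ← QuotientGroup.eq_one_iff, h, funext_iff, funext_iff]
    rfl

/-- A witness for membership in the span involves finitely many group elements; together with `z`
they generate `H`, and `K H → K G` is injective. -/
theorem exists_fg_of_sub_one_mem_weightFiltration {K : Type*} [Field K] {G : Type*} [Group G]
    {F : ℕ → Subgroup G} {n : ℕ} {z : G} (hz : of K G z - 1 ∈ weightFiltration K F n) :
    ∃ (H : Subgroup G) (_ : H.FG) (hzH : z ∈ H),
      of K H ⟨z, hzH⟩ - 1 ∈ weightFiltration K (fun i => (F i).comap H.subtype) n := by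
  have mono : ∀ {H₁ H₂ : Subgroup G} (_ : H₁ ≤ H₂) {a : MonoidAlgebra K G},
      (∃ b ∈ weightFiltration K (fun i => (F i).comap H₁.subtype) n,
        mapDomainAlgHom K K H₁.subtype b = a) →
      ∃ b ∈ weightFiltration K (fun i => (F i).comap H₂.subtype) n,
        mapDomainAlgHom K K H₂.subtype b = a := by
    rintro H₁ H₂ hle _ ⟨b, hb, rfl⟩
    refine ⟨mapDomainAlgHom K K (Subgroup.inclusion hle) b,
      map_mem_weightFiltration _ (fun i g hg => hg) hb, ?_⟩
    rw [← AlgHom.comp_apply, ← MonoidAlgebra.mapDomainAlgHom_comp, Subgroup.subtype_comp_inclusion]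
  have key : ∀ a ∈ weightFiltration K F n, ∃ H : Subgroup G, H.FG ∧
      ∃ b ∈ weightFiltration K (fun i => (F i).comap H.subtype) n,
        mapDomainAlgHom K K H.subtype b = a := by
    intro a ha
    induction ha using Submodule.span_induction with
    | mem a ha =>
      obtain ⟨l, hl, hn, rfl⟩ := ha
      have hlH : ∀ p ∈ l, p.1 ∈ Subgroup.closure {g | ∃ p ∈ l, p.1 = g} :=
        fun p hp => Subgroup.subset_closure ⟨p, hp, rfl⟩
      refine ⟨Subgroup.closure {g | ∃ p ∈ l, p.1 = g}, ?_, _,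
        list_prod_mem_weightFiltration
          (l := l.attach.map fun p => (⟨p.1.1, hlH p.1 p.2⟩, p.1.2)) ?_ ?_, ?_⟩
      · exact (Subgroup.fg_iff _).2 ⟨_, rfl, (l.finite_toSet.image Prod.fst)⟩
      · intro p hp
        obtain ⟨q, -, rfl⟩ := List.mem_map.1 hp
        exact hl q.1 q.2
      · rw [List.map_map]
        change n ≤ (l.attach.map fun p => p.1.2).sum
        rwa [List.attach_map_val (f := Prod.snd)]
      · rw [map_list_prod, List.map_map, List.map_map,
          ← List.attach_map_val (l := l) (f := fun p => of K G p.1 - 1)]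
        refine congrArg List.prod (List.map_congr_left fun p _ => ?_)
        rw [Function.comp_apply, Function.comp_apply, map_sub, map_one, mapDomainAlgHom_of]
        rfl
    | zero => exact ⟨⊥, ⟨∅, by simp⟩, 0, zero_mem _, map_zero _⟩
    | add a b _ _ ha hb =>
      obtain ⟨H₁, h₁, ha⟩ := ha
      obtain ⟨H₂, h₂, hb⟩ := hb
      obtain ⟨a', ha', rfl⟩ := mono (le_sup_left : H₁ ≤ H₁ ⊔ H₂) ha
      obtain ⟨b', hb', rfl⟩ := mono (le_sup_right : H₂ ≤ H₁ ⊔ H₂) hb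
      exact ⟨H₁ ⊔ H₂, h₁.sup h₂, a' + b', add_mem ha' hb', map_add _ _ _⟩
    | smul c a _ ha =>
      obtain ⟨H, h, a', ha', rfl⟩ := ha
      exact ⟨H, h, c • a', Submodule.smul_mem _ c ha', map_smul _ _ _⟩
  obtain ⟨H, hH, h⟩ := key _ hz
  obtain ⟨b, hb, hbz⟩ := mono (le_sup_left : H ≤ H ⊔ Subgroup.zpowers z) h
  have hzH : z ∈ H ⊔ Subgroup.zpowers z :=
    (le_sup_right : Subgroup.zpowers z ≤ H ⊔ Subgroup.zpowers z) (Subgroup.mem_zpowers z)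
  refine ⟨H ⊔ Subgroup.zpowers z, hH.sup ?_, hzH, ?_⟩
  · exact (Subgroup.fg_iff _).2 ⟨{z}, (Subgroup.zpowers_eq_closure z).symm, Set.finite_singleton z⟩
  · have hinj : Function.Injective (mapDomainAlgHom K K (H ⊔ Subgroup.zpowers z).subtype) :=
      MonoidAlgebra.mapDomain_injective (Subgroup.subtype_injective _)
    have : of K (H ⊔ Subgroup.zpowers z : Subgroup G) ⟨z, hzH⟩ - 1 = b := by
      apply hinj
      rw [hbz, map_sub, map_one, mapDomainAlgHom_of]
      rfl
    rwa [this]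

theorem IsIsolatedNSeries.mem_of_of_sub_one_mem.{u} {K : Type*} [Field K] [CharZero K]
    {G : Type u} [Group G] {F : ℕ → Subgroup G} (hF : IsIsolatedNSeries F) (h1 : F 1 = ⊤) {n : ℕ}
    {z : G} (hz : of K G z - 1 ∈ weightFiltration K F n) : z ∈ F n := by
  -- Here `d` bounds `n - w`. The group varies because each stage passes to subgroups.
  have key : ∀ d w : ℕ, 1 ≤ w → n ≤ w + d → ∀ (G : Type u) [Group G] (F : ℕ → Subgroup G),
      IsIsolatedNSeries F → F w = ⊤ →
      ∀ z : G, of K G z - 1 ∈ weightFiltration K F n → z ∈ F n := by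
    intro d
    induction d with
    | zero => exact fun w _ hn G _ F hF hw z _ => hF.antitone hn (hw ▸ Subgroup.mem_top z)
    | succ d ih =>
      intro w hw1 hn G _ F hF hw z hz
      obtain ⟨H, hH, hzH, h⟩ := exists_fg_of_sub_one_mem_weightFiltration hz
      have : Group.FG H := (Group.fg_iff_subgroup_fg H).2 hH
      have hFH := hF.comap H.subtype
      have hwH : (F w).comap H.subtype = ⊤ := by rw [hw, Subgroup.comap_top]
      obtain ⟨r, φ, hφ⟩ := hFH.exists_ker_eq hw1 hwH
      exact mem_of_quotient_embeds_free (K := K) (ih (w + 1) (by omega) (by omega)) r H _ hFH hwH φ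
        hφ ⟨z, hzH⟩ h
  exact key n 1 le_rfl (by omega) G F hF h1 z hz

/-! ### Powers of the difference ideal and the conclusion. -/

section differenceIdeal

variable {K : Type*} [Field K] {G : Type*} [Group G]

theorem of_sub_one_mem_differenceIdeal (g : G) : of K G g - 1 ∈ differenceIdeal K G := by
  rw [differenceIdeal, RingHom.mem_ker, map_sub, map_one, augmentation, MonoidAlgebra.lift_of,
    MonoidHom.one_apply, sub_self]

theorem differenceIdeal_pow_antitone : Antitone fun n : ℕ => differenceIdeal K G ^ n :=
  fun _ _ h => Ideal.pow_le_pow_right h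

theorem differenceIdeal_pow_le_weightFiltration {F : ℕ → Subgroup G} (h0 : F 0 = ⊤) (h1 : F 1 = ⊤)
    (n : ℕ) : ∀ a ∈ differenceIdeal K G ^ n, a ∈ weightFiltration K F n := by
  induction n with
  | zero =>
    intro a ha
    clear ha
    induction a using MonoidAlgebra.induction_on with
    | of g => exact of_mem_weightFiltration_zero h0 g
    | add a b ha hb => exact add_mem ha hb
    | smul c a ha => exact Submodule.smul_mem _ c ha
  | succ n ih =>
    -- For `a ∈ Δ` the subtracted term is zero, so this places `Δ` in weight `1`.
    have hΔ : ∀ a : MonoidAlgebra K G,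
        a - algebraMap K _ (augmentation K G a) ∈ weightFiltration K F 1 := by
      intro a
      induction a using MonoidAlgebra.induction_on with
      | of g =>
        rw [augmentation, MonoidAlgebra.lift_of, MonoidHom.one_apply, map_one]
        exact of_sub_one_mem_weightFiltration (h1 ▸ Subgroup.mem_top g)
      | add a b ha hb =>
        rw [map_add, map_add, add_sub_add_comm]
        exact add_mem ha hb
      | smul c a ha =>
        rw [map_smul, smul_eq_mul, map_mul, ← Algebra.smul_def, ← smul_sub]
        exact Submodule.smul_mem _ c ha
    intro a ha
    rw [Submodule.pow_succ] at ha
    induction ha using Submodule.mul_induction_on' with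
    | mem_mul_mem a ha b hb =>
      have h := hΔ b
      rw [show augmentation K G b = 0 from hb, map_zero, sub_zero] at h
      exact mul_mem_weightFiltration (ih a ha) h
    | add a _ b _ ha hb => exact add_mem ha hb

theorem lowerCentralTerm_le_dimensionSubgroup {n : ℕ} (hn : 1 ≤ n) :
    lowerCentralTerm G n ≤ dimensionSubgroup K G n := by
  induction n, hn using Nat.le_induction with
  | base =>
    intro g _
    rw [mem_dimensionSubgroup, Submodule.pow_one]
    exact of_sub_one_mem_differenceIdeal g
  | succ n hn ih =>
    rw [lowerCentralTerm_succ n hn, Subgroup.commutator_le]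
    intro x hx y _
    have hx' := (mem_dimensionSubgroup K n x).1 (ih hx)
    have hy := of_sub_one_mem_differenceIdeal (K := K) y
    have h : of K G ⁅x, y⁆ - 1 = ((of K G x - 1) * (of K G y - 1) -
        (of K G y - 1) * (of K G x - 1)) * of K G (x⁻¹ * y⁻¹) := by
      have h1 : (of K G x - 1) * (of K G y - 1) - (of K G y - 1) * (of K G x - 1) =
          of K G (x * y) - of K G (y * x) := by
        rw [map_mul, map_mul]; noncomm_ring
      rw [h1, sub_mul, ← map_mul, ← map_mul, commutatorElement_def]
      congr 2
      · simp only [mul_assoc]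
      · rw [← map_one (of K G)]; congr 1; group
    rw [mem_dimensionSubgroup, h]
    refine Ideal.mul_mem_right _ _ (sub_mem ?_ ?_)
    · rw [Submodule.pow_succ]; exact Ideal.mul_mem_mul hx' hy
    · rw [Ideal.IsTwoSided.pow_succ]; exact Ideal.mul_mem_mul hy hx'

/-- In `x ^ m - 1 = (x - 1)(1 + x + ⋯ + x ^ (m - 1))` the last factor is `m` modulo `Δ`. As `m` is
invertible in `K`, `x - 1` climbs from `Δ ^ k` to `Δ ^ (k + 1)` for each `k < n`. -/
theorem mem_dimensionSubgroup_of_pow_mem [CharZero K] {n m : ℕ} (hm : 0 < m) {x : G}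
    (hx : x ^ m ∈ dimensionSubgroup K G n) : x ∈ dimensionSubgroup K G n := by
  have key : ∀ k ≤ n, of K G x - 1 ∈ differenceIdeal K G ^ k := by
    intro k
    induction k with
    | zero => intro _; rw [Submodule.pow_zero, Ideal.one_eq_top]; exact Submodule.mem_top
    | succ k ih =>
      intro hk
      have hxk := ih (by omega)
      have hsum : ∑ i ∈ Finset.range m, of K G x ^ i - (m : MonoidAlgebra K G) ∈
          differenceIdeal K G := by
        have : ∑ i ∈ Finset.range m, of K G x ^ i - (m : MonoidAlgebra K G) =
            ∑ i ∈ Finset.range m, (of K G (x ^ i) - 1) := by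
          simp [Finset.sum_sub_distrib]
        rw [this]
        exact sum_mem fun i _ => of_sub_one_mem_differenceIdeal _
      have h1 : (m : K) • (of K G x - 1) = (of K G (x ^ m) - 1) -
          (of K G x - 1) * (∑ i ∈ Finset.range m, of K G x ^ i - (m : MonoidAlgebra K G)) := by
        rw [mul_sub, mul_geom_sum, map_pow, sub_sub_cancel, Nat.cast_smul_eq_nsmul,
          nsmul_eq_mul, Nat.cast_comm]
      have h2 : (m : K) • (of K G x - 1) ∈ differenceIdeal K G ^ (k + 1) := by
        rw [h1]
        refine sub_mem (differenceIdeal_pow_antitone hk hx) ?_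
        rw [Submodule.pow_succ]
        exact Ideal.mul_mem_mul hxk hsum
      have hm0 : (m : K) ≠ 0 := Nat.cast_ne_zero.2 hm.ne'
      have h3 := Ideal.mul_mem_left _ (algebraMap K _ (m : K)⁻¹) h2
      rwa [← Algebra.smul_def, smul_smul, inv_mul_cancel₀ hm0, one_smul] at h3
  exact key n le_rfl

theorem isIsolatedNSeries_rootLowerCentralTerm (G : Type*) [Group G] :
    IsIsolatedNSeries (rootLowerCentralTerm G) where
  -- Truncated subtraction makes the term of index `0` equal to `γ₁(G) = G`.
  zero := top_le_iff.1 (lowerCentralTerm_le_rootLowerCentralTerm G 0)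
  antitone := rootLowerCentralTerm_antitone G
  commutator_mem := commutatorElement_mem_rootLowerCentralTerm
  isolated := isIsolated_rootLowerCentralTerm G

theorem dimensionSubgroup_eq_rootLowerCentralTerm [CharZero K] {n : ℕ} (hn : 1 ≤ n) :
    dimensionSubgroup K G n = rootLowerCentralTerm G n := by
  have hF := isIsolatedNSeries_rootLowerCentralTerm G
  have h1 : rootLowerCentralTerm G 1 = ⊤ :=
    top_le_iff.1 (lowerCentralTerm_le_rootLowerCentralTerm G 1)
  apply le_antisymm
  · exact fun x hx => hF.mem_of_of_sub_one_mem h1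
      (differenceIdeal_pow_le_weightFiltration (K := K) hF.zero h1 n _ hx)
  · rintro x ⟨m, hm, h⟩
    exact mem_dimensionSubgroup_of_pow_mem hm (lowerCentralTerm_le_dimensionSubgroup hn h)

end differenceIdeal

end Jennings

theorem theorem7p1 {G : Type*} [Group G] (K : Type*) [Field K] [CharZero K]
    (n : ℕ) (hn : 1 ≤ n) :
    (∀ x : G, x ∈ Jennings.dimensionSubgroup K G n ↔
      ∃ m : ℕ, 0 < m ∧ x ^ m ∈ Jennings.lowerCentralTerm G n) ∧
    Jennings.dimensionSubgroup K G n = Jennings.isolator (Jennings.lowerCentralTerm G n) ∧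
    ∀ (L : Type*) [Field L] [CharZero L],
      Jennings.dimensionSubgroup L G n = Jennings.dimensionSubgroup K G n := by
  refine ⟨fun x => ?_, ?_, fun L _ _ => ?_⟩
  · rw [Jennings.dimensionSubgroup_eq_rootLowerCentralTerm hn]
    exact Jennings.mem_rootLowerCentralTerm
  · rw [Jennings.dimensionSubgroup_eq_rootLowerCentralTerm hn, Jennings.isolator_lowerCentralTerm]
  · rw [Jennings.dimensionSubgroup_eq_rootLowerCentralTerm hn,
      Jennings.dimensionSubgroup_eq_rootLowerCentralTerm hn]
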